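/- Let $(\mathcal T(n) : n\ge 1)$ be the Barabási–Albert tree process: $\mathcal T(1)$ is the single vertex $1$ (Adam), $\mathcal T(2)$ is the edge joining vertex $2$ to vertex $1$, and for $n\ge 2$ the tree $\mathcal T(n+1)$ is obtained from $\mathcal T(n)$ by joining the new vertex $n+1$ to a random vertex $i\in\{1,\dots,n\}$ which, conditionally on $\mathcal T(1),\dots,\mathcal T(n)$, is chosen with probability $\frac{d_i(n)}{2(n-1)}$, where $d_i(n)$ is the degree of $i$ in $\mathcal T(n)$. For $n\ge 2$ put $\alpha_n=\prod_{k=1}^{n-2}\bigl(1+\frac1{2k}\bigr)$ and $D_i(n)=\frac{d_i(n)}{\alpha_n\sqrt{\pi}}$ for $1\le i\le n$. For $\varepsilon\in(0,1)$ and $n\ge 2$, the $\varepsilon$-packet $\mathcal P_\varepsilon(n)$ is the set of all $i\in\{1,\dots,n\}$ that have a neighbour $j$ in $\mathcal T(n)$ with $D_j(n)\,D_i(n)^2>\varepsilon$ or $D_i(n)\,D_j(n)^2>\varepsilon$. Fix $\eta\in(0,1)$. Then there is $\varepsilon_0>0$, depending only on $\eta$, such that for all $\varepsilon\in(0,\varepsilon_0)$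 $$\mathbb P\bigl(1\in\mathcal P_\varepsilon(n)\text{ for all } n\ge 2\bigr)\ \ge\ 1-\varepsilon^{1-\eta}.$$ -/

import Mathlib

open MeasureTheory ProbabilityTheory

namespace BarabasiAlbert

/-- The labelled tree `𝒯(n)` on the vertex set `{1, …, n}`, when `u m` is the label of the vertex to
which the vertex `m` attaches, `2 ≤ m ≤ n`: its edges are the pairs `{m, u m}`. The graph lives on
the type `ℕ` of all labels; labels outside `{1, …, n}` are not vertices of `𝒯(n)`. -/
def tree (u : ℕ → ℕ) (n : ℕ) : SimpleGraph ℕ :=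
  SimpleGraph.fromEdgeSet {e | ∃ m : ℕ, 2 ≤ m ∧ m ≤ n ∧ e = s(m, u m)}

/-- `d_i(n)`, the degree of the vertex `i` in `𝒯(n)`. -/
noncomputable def deg (u : ℕ → ℕ) (n i : ℕ) : ℕ :=
  ((tree u n).neighborSet i).ncard

/-- `F_n`, the information carried by the attachments up to time `n`, that is by
`𝒯(1), …, 𝒯(n)`. -/
@[reducible] def past {Ω : Type*} (U : ℕ → Ω → ℕ) (n : ℕ) : MeasurableSpace Ω :=
  ⨆ m ∈ Set.Icc 2 n, MeasurableSpace.comap (U m) ⊤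

/-- `U m` is the (random) label of the vertex to which the vertex `m` attaches in a Barabási–Albert
tree process: the vertex `2` attaches to the vertex `1`, and for `n ≥ 2`, conditionally on the past
up to time `n`, the vertex `n + 1` attaches to the vertex `i ∈ {1, …, n}` with probability
proportional to the degree of `i` in `𝒯(n)`; the sum of these degrees is `2 (n - 1)`. -/
structure IsProcess {Ω : Type*} [MeasurableSpace Ω] (P : Measure Ω) (U : ℕ → Ω → ℕ) : Prop where
  measurable : ∀ m, 2 ≤ m → Measurable (U m)
  second : ∀ᵐ ω ∂P, U 2 ω = 1
  attach : ∀ n, 2 ≤ n → ∀ i, 1 ≤ i → i ≤ n →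
    P[Set.indicator {ω | U (n + 1) ω = i} (fun _ => (1 : ℝ)) | past U n] =ᵐ[P]
      fun ω => (deg (fun m => U m ω) n i : ℝ) / (2 * ((n : ℝ) - 1))

/-- `α_n = ∏_{k=1}^{n-2} (1 + 1/(2k))` for `n ≥ 2`. -/
noncomputable def alpha (n : ℕ) : ℝ :=
  ∏ k ∈ Finset.Icc 1 (n - 2), (1 + 1 / (2 * (k : ℝ)))

/-- The renormalized degree `D_i(n) = d_i(n) / (α_n √π)`, for `n ≥ 2`. -/
noncomputable def normDeg (u : ℕ → ℕ) (n i : ℕ) : ℝ :=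
  (deg u n i : ℝ) / (alpha n * Real.sqrt Real.pi)

/-- The `ε`-packet of `𝒯(n)`, for `n ≥ 2`. -/
def packet (u : ℕ → ℕ) (ε : ℝ) (n : ℕ) : Set ℕ :=
  {i | 1 ≤ i ∧ i ≤ n ∧ ∃ j, 1 ≤ j ∧ j ≤ n ∧ (tree u n).Adj j i ∧
    (normDeg u n j * normDeg u n i ^ 2 > ε ∨ normDeg u n i * normDeg u n j ^ 2 > ε)}

end BarabasiAlbert

/-!
The vertices `1` and `2` are adjacent at all times, so Adam can only leave the packet at a time `n`
at which the degrees `a`, `b` of these two vertices satisfy both `a² b ≤ ε A³` and `a b² ≤ ε A³`,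
where `A = α_n √π`; then `a b (a + b) ≤ 2 ε A³`. The pair `(a, b)` is a Markov chain of its own, so
this event is controlled by a nonnegative martingale that is large when `a b (a + b)` is small
compared with `α_n³`.

For `0 ≤ s < 1` such a martingale is built from the `potential`, the product of the three gamma
quotients `Γ(a - s) / Γ(a)`, `Γ(b - s) / Γ(b)` and `Γ(a + b - 3s) / Γ(a + b - 2s)`, up to a constant.
The first two are eigenfunctions of the growth of `a` and of `b`, and the third is chosen so that
the product is one of the joint growth, with eigenvalue `-3s` (`potential_drift`). Divided by its
expected decay it becomes a martingale (`IsProcess.martingale_potential`). By Bernoulli's inequality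
the potential is at least `(1 - s)³ (a b (a + b)) ^ (-s)`, and the expected decay is at most a
multiple of `α_n ^ (-3s)`; hence the martingale is at least `(1 - s)³ ε ^ (-s) / 54` when Adam is not
in the packet (`le_potential_div_decay_of_notMem_packet`). It starts at a value at most `1`, so
Ville's inequality bounds the probability that this ever happens by `54 ε ^ s / (1 - s)³`; take
`s = 1 - η / 2`.

The third gamma quotient is positive for all `s < 1` only if `a + b ≥ 3`, which is why the martingale
starts at time `3`, when `{a, b} = {1, 2}`; at time `2` Adam is in the packet as soon as `ε < 1 / 8`.
-/

namespace BarabasiAlbert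

/-! ### A product of gamma type and its decay -/

/-- The product `∏_{k < n} (1 - s / (x + k))`, that is
`Γ(x + n - s) Γ(x) / (Γ(x + n) Γ(x - s))`, which decays like `(x + n) ^ (-s)`. -/
noncomputable def shrink (s x : ℝ) (n : ℕ) : ℝ :=
  ∏ k ∈ Finset.range n, (1 - s / (x + k))

lemma shrink_succ (s x : ℝ) (n : ℕ) :
    shrink s x (n + 1) = shrink s x n * (1 - s / (x + n)) := by
  simp [shrink, Finset.prod_range_succ]

lemma shrink_factor_mem {s x : ℝ} (hs0 : 0 ≤ s) (hs1 : s ≤ 1) (hx : 1 ≤ x) (k : ℕ) :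
    0 ≤ 1 - s / (x + k) ∧ 1 - s / (x + k) ≤ 1 := by
  have hk : (0 : ℝ) ≤ k := k.cast_nonneg
  have h1 : s / (x + k) ≤ 1 := by rw [div_le_one (by linarith)]; linarith
  have h2 : 0 ≤ s / (x + k) := by positivity
  constructor <;> linarith

lemma shrink_nonneg {s x : ℝ} (hs0 : 0 ≤ s) (hs1 : s ≤ 1) (hx : 1 ≤ x) (n : ℕ) :
    0 ≤ shrink s x n :=
  Finset.prod_nonneg fun k _ => (shrink_factor_mem hs0 hs1 hx k).1

lemma shrink_le_one {s x : ℝ} (hs0 : 0 ≤ s) (hs1 : s ≤ 1) (hx : 1 ≤ x) (n : ℕ) :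
    shrink s x n ≤ 1 :=
  Finset.prod_le_one (fun k _ => (shrink_factor_mem hs0 hs1 hx k).1)
    fun k _ => (shrink_factor_mem hs0 hs1 hx k).2

/-- The lower bound `shrink s x n ≥ (1 - s) (x + n) ^ (-s)`. Bernoulli's inequality bounds each
factor but the first below by `((x + k - 1) / (x + k)) ^ s`, and these powers telescope. -/
lemma one_sub_le_shrink_mul_rpow {s x : ℝ} (hs0 : 0 ≤ s) (hs1 : s ≤ 1) (hx : 1 ≤ x) (n : ℕ) :
    1 - s ≤ shrink s x n * (x + n) ^ s := by
  have key : ∀ m : ℕ, 1 - s ≤ shrink s x (m + 1) * (x + m) ^ s := by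
    intro m
    induction m with
    | zero =>
      have h1 : 1 ≤ x ^ s := Real.one_le_rpow hx hs0
      have h2 : s / x ≤ s := div_le_self hs0 hx
      simp only [shrink, zero_add, Finset.range_one, Finset.prod_singleton, Nat.cast_zero, add_zero]
      nlinarith [mul_nonneg (sub_nonneg.2 (h2.trans hs1)) (sub_nonneg.2 h1)]
    | succ m ih =>
      have hm : (0 : ℝ) ≤ m := m.cast_nonneg
      have hpos : 0 < x + (m + 1 : ℕ) := by positivity
      have hb : (1 + -(1 / (x + (m + 1 : ℕ)))) ^ s ≤ 1 + s * -(1 / (x + (m + 1 : ℕ))) := by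
        refine rpow_one_add_le_one_add_mul_self ?_ hs0 hs1
        rw [neg_le_neg_iff, div_le_one hpos]
        push_cast; linarith
      have hratio : 1 + -(1 / (x + (m + 1 : ℕ))) = (x + m) / (x + (m + 1 : ℕ)) := by
        field_simp; push_cast; ring
      rw [hratio, Real.div_rpow (by linarith) hpos.le,
        div_le_iff₀ (Real.rpow_pos_of_pos hpos s)] at hb
      calc 1 - s ≤ shrink s x (m + 1) * (x + m) ^ s := ih
        _ ≤ shrink s x (m + 1) *
            ((1 + s * -(1 / (x + (m + 1 : ℕ)))) * (x + (m + 1 : ℕ)) ^ s) :=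
          mul_le_mul_of_nonneg_left hb (shrink_nonneg hs0 hs1 hx _)
        _ = shrink s x (m + 1 + 1) * (x + (m + 1 : ℕ)) ^ s := by
          rw [shrink_succ s x (m + 1)]; ring
  cases n with
  | zero =>
    have h1 : 1 ≤ x ^ s := Real.one_le_rpow hx hs0
    simp only [shrink, Finset.range_zero, Finset.prod_empty, Nat.cast_zero, add_zero, one_mul]
    linarith
  | succ m =>
    refine (key m).trans (mul_le_mul_of_nonneg_left ?_ (shrink_nonneg hs0 hs1 hx _))
    refine Real.rpow_le_rpow (by positivity) ?_ hs0
    push_cast; linarith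

/-! ### The potential of two degrees -/

/-- The potential of the degrees `a = p + 1` and `b = q + 1` of two vertices, an eigenfunction of
their joint growth which is comparable to `(a b (a + b)) ^ (-s)`. The subtraction is meant for
`p + q ≥ 1`, that is for degrees after the third vertex has come. -/
noncomputable def potential (s : ℝ) (p q : ℕ) : ℝ :=
  shrink s 1 p * shrink s 1 q * shrink s (3 - 2 * s) (p + q - 1)

lemma potential_nonneg {s : ℝ} (hs0 : 0 ≤ s) (hs1 : s ≤ 1) (p q : ℕ) : 0 ≤ potential s p q :=
  mul_nonneg (mul_nonneg (shrink_nonneg hs0 hs1 le_rfl _) (shrink_nonneg hs0 hs1 le_rfl _))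
    (shrink_nonneg hs0 hs1 (by linarith) _)

lemma potential_le_one {s : ℝ} (hs0 : 0 ≤ s) (hs1 : s ≤ 1) (p q : ℕ) : potential s p q ≤ 1 :=
  mul_le_one₀ (mul_le_one₀ (shrink_le_one hs0 hs1 le_rfl _) (shrink_nonneg hs0 hs1 le_rfl _)
    (shrink_le_one hs0 hs1 le_rfl _)) (shrink_nonneg hs0 hs1 (by linarith) _)
    (shrink_le_one hs0 hs1 (by linarith) _)

/-- The potential is an eigenfunction, with eigenvalue `-3s`, of the generator of the pair of
degrees, in which a degree `a` grows to `a + 1` at rate `a`. -/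
lemma potential_drift {s : ℝ} (hs1 : s < 1) {p q : ℕ} (hpq : 1 ≤ p + q) :
    ((p : ℝ) + 1) * (potential s (p + 1) q - potential s p q) +
      ((q : ℝ) + 1) * (potential s p (q + 1) - potential s p q) = -(3 * s) * potential s p q := by
  obtain ⟨r, hr⟩ : ∃ r, p + q = r + 1 := ⟨p + q - 1, by omega⟩
  have e1 : p + 1 + q - 1 = r + 1 := by omega
  have e2 : p + (q + 1) - 1 = r + 1 := by omega
  have e3 : p + q - 1 = r := by omega
  have hrr : (r : ℝ) = p + q - 1 := by
    have : ((p + q : ℕ) : ℝ) = (r + 1 : ℕ) := by rw [hr]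
    push_cast at this; linarith
  have hr0 : (0 : ℝ) ≤ r := r.cast_nonneg
  simp only [potential, e1, e2, e3, shrink_succ]
  have hx : s / (1 + p) * (1 + p) = s := div_mul_cancel₀ s (by positivity)
  have hz : s / (1 + q) * (1 + q) = s := div_mul_cancel₀ s (by positivity)
  have hy : s / (3 - 2 * s + r) * (3 - 2 * s + r) = s := div_mul_cancel₀ s (by linarith)
  generalize s / (1 + (p : ℝ)) = x at hx ⊢
  generalize s / (1 + (q : ℝ)) = z at hz ⊢
  generalize s / (3 - 2 * s + (r : ℝ)) = y at hy ⊢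
  rw [hrr] at hy
  linear_combination
    -(shrink s 1 p * shrink s 1 q * shrink s (3 - 2 * s) r) * ((1 - y) * (hx + hz) + hy)

lemma le_potential_mul_rpow {s : ℝ} (hs0 : 0 ≤ s) (hs1 : s ≤ 1) {p q : ℕ} (hpq : 1 ≤ p + q) :
    (1 - s) ^ 3 ≤ potential s p q *
      (((p : ℝ) + 1) * ((q : ℝ) + 1) * (((p : ℝ) + 1) + ((q : ℝ) + 1))) ^ s := by
  have h1 := one_sub_le_shrink_mul_rpow hs0 hs1 (le_refl 1) p
  have h2 := one_sub_le_shrink_mul_rpow hs0 hs1 (le_refl 1) q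
  have h3 := one_sub_le_shrink_mul_rpow hs0 hs1 (show 1 ≤ 3 - 2 * s by linarith) (p + q - 1)
  have h4 : (3 - 2 * s + ((p + q - 1 : ℕ) : ℝ)) ^ s ≤ (((p : ℝ) + 1) + ((q : ℝ) + 1)) ^ s := by
    refine Real.rpow_le_rpow (by have := (p + q - 1).cast_nonneg (α := ℝ); linarith) ?_ hs0
    rw [Nat.cast_sub hpq]; push_cast; linarith
  have h5 := h3.trans (mul_le_mul_of_nonneg_left h4 (shrink_nonneg hs0 hs1 (by linarith) _))
  have hs : 0 ≤ 1 - s := by linarith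
  calc (1 - s) ^ 3 = (1 - s) * (1 - s) * (1 - s) := by ring
    _ ≤ _ := mul_le_mul (mul_le_mul h1 h2 hs (hs.trans h1)) h5 hs
          (mul_nonneg (hs.trans h1) (hs.trans h2))
    _ = _ := by
      rw [Real.mul_rpow (by positivity) (by positivity),
        Real.mul_rpow (by positivity) (by positivity), potential, add_comm 1 (p : ℝ),
        add_comm 1 (q : ℝ)]
      ring

/-! ### The normalization of the potential -/

/-- The expected decay `∏_{k=2}^{n-2} (1 - 3s / (2k))` of the potential between the times `3` and
`n`. -/
noncomputable def decay (s : ℝ) (n : ℕ) : ℝ :=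
  ∏ k ∈ Finset.Ico 2 (n - 1), (1 - 3 * s / (2 * (k : ℝ)))

lemma decay_succ (s : ℝ) {n : ℕ} (hn : 3 ≤ n) :
    decay s (n + 1) = decay s n * (1 - 3 * s / (2 * ((n : ℝ) - 1))) := by
  obtain ⟨m, rfl⟩ : ∃ m, n = m + 1 := ⟨n - 1, by omega⟩
  simp only [decay, Nat.add_sub_cancel]
  rw [Finset.prod_Ico_succ_top (by omega)]
  push_cast
  ring_nf

lemma decay_factor_pos {s : ℝ} (hs1 : s ≤ 1) {k : ℕ} (hk : 2 ≤ k) :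
    0 < 1 - 3 * s / (2 * (k : ℝ)) := by
  have hk' : (2 : ℝ) ≤ k := by exact_mod_cast hk
  rw [sub_pos, div_lt_one (by linarith)]
  linarith

lemma decay_pos {s : ℝ} (hs1 : s ≤ 1) (n : ℕ) : 0 < decay s n :=
  Finset.prod_pos fun _ hk => decay_factor_pos hs1 (Finset.mem_Ico.1 hk).1

lemma alpha_succ {n : ℕ} (hn : 2 ≤ n) :
    alpha (n + 1) = alpha n * (1 + 1 / (2 * ((n : ℝ) - 1))) := by
  obtain ⟨m, rfl⟩ : ∃ m, n = m + 2 := ⟨n - 2, by omega⟩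
  simp only [alpha, show m + 2 + 1 - 2 = m + 1 by omega, Nat.add_sub_cancel]
  rw [Finset.prod_Icc_succ_top (by omega)]
  push_cast
  ring_nf

lemma alpha_pos (n : ℕ) : 0 < alpha n := Finset.prod_pos fun k _ => by positivity

/-- The normalization of the potential decays at least as fast as `α_n ^ (-3s)`. -/
lemma decay_mul_alpha_rpow_le {s : ℝ} (hs0 : 0 ≤ s) (hs1 : s ≤ 1) {n : ℕ} (hn : 3 ≤ n) :
    decay s n * alpha n ^ (3 * s) ≤ 27 / 8 := by
  induction n, hn using Nat.le_induction with
  | base =>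
    have h1 : decay s 3 = 1 := by simp [decay]
    have h2 : alpha 3 = 3 / 2 := by simp [alpha]; norm_num
    rw [h1, h2, one_mul]
    calc (3 / 2 : ℝ) ^ (3 * s) ≤ (3 / 2 : ℝ) ^ (3 : ℝ) :=
          Real.rpow_le_rpow_of_exponent_le (by norm_num) (by linarith)
      _ = 27 / 8 := by norm_num
  | succ n hn ih =>
    have hn' : (3 : ℝ) ≤ n := by exact_mod_cast hn
    set x : ℝ := 1 / (2 * ((n : ℝ) - 1)) with hx
    have hx0 : 0 < x := by rw [hx]; apply one_div_pos.2; linarith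
    have hx1 : x ≤ 1 / 4 := by
      rw [hx]; exact one_div_le_one_div_of_le (by norm_num) (by linarith)
    have hf : 1 - 3 * s / (2 * ((n : ℝ) - 1)) = 1 - 3 * s * x := by rw [hx]; ring
    have hpos : 0 ≤ 1 - 3 * s * x := by nlinarith
    have hstep : (1 - 3 * s * x) * (1 + x) ^ (3 * s) ≤ 1 := by
      have e1 : 1 - 3 * s * x ≤ Real.exp (-(3 * s * x)) := by
        linarith [Real.add_one_le_exp (-(3 * s * x))]
      have e2 : (1 + x) ^ (3 * s) ≤ Real.exp (3 * s * x) := by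
        calc (1 + x) ^ (3 * s) ≤ Real.exp x ^ (3 * s) :=
              Real.rpow_le_rpow (by linarith) (by linarith [Real.add_one_le_exp x]) (by linarith)
          _ = Real.exp (3 * s * x) := by rw [← Real.exp_mul]; ring_nf
      calc _ ≤ Real.exp (-(3 * s * x)) * Real.exp (3 * s * x) :=
            mul_le_mul e1 e2 (by positivity) (by positivity)
        _ = 1 := by rw [← Real.exp_add]; simp
    rw [decay_succ s hn, alpha_succ (by omega), hf,
      Real.mul_rpow (alpha_pos n).le (by linarith)]
    have h0 : 0 ≤ decay s n * alpha n ^ (3 * s) :=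
      mul_nonneg (decay_pos hs1 n).le (Real.rpow_nonneg (alpha_pos n).le _)
    calc _ = decay s n * alpha n ^ (3 * s) * ((1 - 3 * s * x) * (1 + x) ^ (3 * s)) := by ring
      _ ≤ decay s n * alpha n ^ (3 * s) := mul_le_of_le_one_right h0 hstep
      _ ≤ 27 / 8 := ih

/-! ### The degrees of the vertices `1` and `2` -/

/-- The number of vertices among `3, …, n` that attach to the vertex `i`. -/
def children (u : ℕ → ℕ) (n i : ℕ) : ℕ :=
  ∑ j ∈ Finset.Icc 3 n, if u j = i then 1 else 0

lemma children_succ (u : ℕ → ℕ) {n : ℕ} (hn : 2 ≤ n) (i : ℕ) :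
    children u (n + 1) i = children u n i + if u (n + 1) = i then 1 else 0 :=
  Finset.sum_Icc_succ_top (by omega) _

lemma tree_adj_two_one {u : ℕ → ℕ} (hu : u 2 = 1) {n : ℕ} (hn : 2 ≤ n) : (tree u n).Adj 2 1 := by
  rw [tree, SimpleGraph.fromEdgeSet_adj]
  exact ⟨⟨2, le_rfl, hn, by rw [hu]⟩, by norm_num⟩

/-- The degrees of the vertices `1` and `2`, whose common edge counts for one each. Nothing is assumed
about the labels `u m` for `m ≥ 3`. -/
lemma deg_eq_children_add_one {u : ℕ → ℕ} (hu : u 2 = 1) {n : ℕ} (hn : 2 ≤ n) {i : ℕ}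
    (hi : i = 1 ∨ i = 2) : deg u n i = children u n i + 1 := by
  have hset : (tree u n).neighborSet i =
      ↑(insert (3 - i) ((Finset.Icc 3 n).filter fun j => u j = i)) := by
    ext j
    simp only [SimpleGraph.mem_neighborSet, tree, SimpleGraph.fromEdgeSet_adj, Set.mem_ofPred_eq,
      Finset.coe_insert, Finset.coe_filter, Finset.mem_Icc, Set.mem_insert_iff, Sym2.eq_iff]
    constructor
    · rintro ⟨⟨m, hm2, hmn, h | h⟩, hne⟩
      · obtain ⟨rfl, rfl⟩ := h
        obtain rfl : i = 2 := by omega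
        left; omega
      · obtain ⟨h1, rfl⟩ := h
        rcases Nat.lt_or_ge j 3 with h3 | h3
        · obtain rfl : j = 2 := by omega
          left; omega
        · exact Or.inr ⟨⟨h3, hmn⟩, h1.symm⟩
    · rintro (h | ⟨⟨h3, hjn⟩, h⟩)
      · rcases hi with rfl | rfl
        · obtain rfl : j = 2 := by omega
          exact ⟨⟨2, le_rfl, hn, Or.inr ⟨hu.symm, rfl⟩⟩, by norm_num⟩
        · obtain rfl : j = 1 := by omega
          exact ⟨⟨2, le_rfl, hn, Or.inl ⟨rfl, hu.symm⟩⟩, by norm_num⟩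
      · exact ⟨⟨j, by omega, hjn, Or.inr ⟨h.symm, rfl⟩⟩, by omega⟩
  rw [deg, hset, Set.ncard_coe_finset, Finset.card_insert_of_notMem, children, Finset.card_filter]
  simp only [Finset.mem_filter, Finset.mem_Icc, not_and]
  omega

/-- If Adam is not in the packet at time `n`, then the product of the degrees of the vertices `1`
and `2` with their sum is small. -/
lemma degree_product_le_of_notMem_packet {u : ℕ → ℕ} (hu : u 2 = 1) {n : ℕ} (hn : 2 ≤ n) {ε : ℝ}
    (h : 1 ∉ packet u ε n) :
    ((children u n 1 : ℝ) + 1) * ((children u n 2 : ℝ) + 1) *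
      (((children u n 1 : ℝ) + 1) + ((children u n 2 : ℝ) + 1)) ≤
        2 * ε * (alpha n * √Real.pi) ^ 3 := by
  have hA : 0 < alpha n * √Real.pi := mul_pos (alpha_pos n) (Real.sqrt_pos.2 Real.pi_pos)
  have h' : ¬ (normDeg u n 2 * normDeg u n 1 ^ 2 > ε ∨ normDeg u n 1 * normDeg u n 2 ^ 2 > ε) :=
    fun hc => h ⟨le_rfl, by omega, 2, by norm_num, hn, tree_adj_two_one hu hn, hc⟩
  simp only [not_or, gt_iff_lt, not_lt, normDeg, deg_eq_children_add_one hu hn (Or.inl rfl),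
    deg_eq_children_add_one hu hn (Or.inr rfl)] at h'
  push_cast at h'
  generalize (children u n 1 : ℝ) + 1 = a at h' ⊢
  generalize (children u n 2 : ℝ) + 1 = b at h' ⊢
  generalize alpha n * √Real.pi = A at h' hA ⊢
  have e1 : b / A * (a / A) ^ 2 = b * a ^ 2 / A ^ 3 := by field_simp
  have e2 : a / A * (b / A) ^ 2 = a * b ^ 2 / A ^ 3 := by field_simp
  rw [e1, e2, div_le_iff₀ (by positivity), div_le_iff₀ (by positivity)] at h'
  nlinarith [h'.1, h'.2]

/-- If Adam is not in the packet, then the normalized potential is large. -/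
lemma le_potential_div_decay_of_notMem_packet {s : ℝ} (hs0 : 0 ≤ s) (hs1 : s ≤ 1) {u : ℕ → ℕ}
    (hu : u 2 = 1) {n : ℕ} (hn : 3 ≤ n) (hc : 1 ≤ children u n 1 + children u n 2) {ε : ℝ}
    (hε : 0 < ε) (h : 1 ∉ packet u ε n) :
    (1 - s) ^ 3 / (54 * ε ^ s) ≤
      potential s (children u n 1) (children u n 2) / decay s n := by
  have hα := alpha_pos n
  have hpot := potential_nonneg hs0 hs1 (children u n 1) (children u n 2)
  have h1 := le_potential_mul_rpow hs0 hs1 hc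
  have h2 := Real.rpow_le_rpow (by positivity)
    (degree_product_le_of_notMem_packet hu (by omega : 2 ≤ n) h) hs0
  have h3 : (2 * ε * (alpha n * √Real.pi) ^ 3) ^ s =
      (2 * √Real.pi ^ 3) ^ s * ε ^ s * alpha n ^ (3 * s) := by
    rw [show 2 * ε * (alpha n * √Real.pi) ^ 3 = (2 * √Real.pi ^ 3) * ε * alpha n ^ 3 by ring,
      Real.mul_rpow (by positivity) (by positivity), Real.mul_rpow (by positivity) hε.le,
      Real.rpow_mul hα.le]
    norm_num
  have h4 : (2 * √Real.pi ^ 3) ^ s ≤ 16 := by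
    have hsq : √Real.pi ≤ 2 := Real.sqrt_le_iff.2 ⟨by norm_num, by linarith [Real.pi_le_four]⟩
    have hsq3 : √Real.pi ^ 3 ≤ 2 ^ 3 := pow_le_pow_left₀ (Real.sqrt_nonneg _) hsq 3
    calc (2 * √Real.pi ^ 3) ^ s ≤ (16 : ℝ) ^ s :=
          Real.rpow_le_rpow (by positivity) (by linarith) hs0
      _ ≤ (16 : ℝ) ^ (1 : ℝ) := Real.rpow_le_rpow_of_exponent_le (by norm_num) hs1
      _ = 16 := by norm_num
  have h5 := decay_mul_alpha_rpow_le hs0 hs1 hn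
  have hd := decay_pos hs1 n
  rw [h3] at h2
  have hεs : 0 < ε ^ s := Real.rpow_pos_of_pos hε s
  have hαs : 0 < alpha n ^ (3 * s) := Real.rpow_pos_of_pos hα _
  rw [div_le_div_iff₀ (by positivity) hd]
  generalize potential s (children u n 1) (children u n 2) = F at *
  calc (1 - s) ^ 3 * decay s n
      ≤ (F * (16 * ε ^ s * alpha n ^ (3 * s))) * decay s n := by
        refine mul_le_mul_of_nonneg_right (h1.trans (mul_le_mul_of_nonneg_left ?_ hpot)) hd.le
        refine h2.trans ?_
        gcongr
    _ = F * 16 * ε ^ s * (decay s n * alpha n ^ (3 * s)) := by ring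
    _ ≤ F * 16 * ε ^ s * (27 / 8) := mul_le_mul_of_nonneg_left h5 (by positivity)
    _ = F * (54 * ε ^ s) := by ring

/-! ### A maximal inequality -/

/-- **Ville's inequality** for a nonnegative supermartingale. -/
lemma measureReal_exists_le_of_supermartingale {Ω : Type*} {m0 : MeasurableSpace Ω} {μ : Measure Ω}
    [IsFiniteMeasure μ] {ℱ : Filtration ℕ m0} {f : ℕ → Ω → ℝ} (hf : Supermartingale f ℱ μ)
    (hnonneg : ∀ n ω, 0 ≤ f n ω) (c : ℝ) :
    c * μ.real {ω | ∃ n, c ≤ f n ω} ≤ ∫ ω, f 0 ω ∂μ := by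
  set A : ℕ → Set Ω := fun n => {ω | ∃ k < n, c ≤ f k ω} with hA
  have hlevel : ∀ k n, k ≤ n → MeasurableSet[ℱ n] {ω | c ≤ f k ω} := fun k n hkn =>
    ((hf.stronglyMeasurable k).mono (ℱ.mono hkn)).measurable measurableSet_Ici
  have hAm : ∀ n, MeasurableSet[ℱ n] (A n) := by
    intro n
    have : A n = ⋃ k ∈ Finset.range n, {ω | c ≤ f k ω} := by ext ω; simp [hA]
    rw [this]
    exact Finset.measurableSet_biUnion _ fun k hk => hlevel k n (Finset.mem_range.1 hk).le
  have hstep : ∀ n, c * μ.real (A n) + ∫ ω in (A n)ᶜ, f n ω ∂μ ≤ ∫ ω, f 0 ω ∂μ := by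
    intro n
    induction n with
    | zero => simp [hA]
    | succ n ih =>
      set B : Set Ω := (A n)ᶜ ∩ {ω | c ≤ f n ω} with hB
      have hBm : MeasurableSet[ℱ n] B := (hAm n).compl.inter (hlevel n n le_rfl)
      have hunion : A (n + 1) = A n ∪ B := by
        ext ω
        simp only [hA, hB, Set.mem_union, Set.mem_inter_iff, Set.mem_compl_iff, Set.mem_ofPred_eq]
        constructor
        · rintro ⟨k, hk, hck⟩
          by_cases h : ∃ k < n, c ≤ f k ω
          · exact Or.inl h
          · obtain rfl | hlt := Nat.lt_succ_iff_lt_or_eq.1 hk |>.symm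
            · exact Or.inr ⟨h, hck⟩
            · exact absurd ⟨k, hlt, hck⟩ h
        · rintro (⟨k, hk, hck⟩ | ⟨-, hck⟩)
          · exact ⟨k, by omega, hck⟩
          · exact ⟨n, by omega, hck⟩
      have hdisj : Disjoint (A n) B :=
        Set.disjoint_left.2 fun ω h1 h2 => h2.1 h1
      have hAn1 : MeasurableSet[ℱ n] (A (n + 1)) := hunion ▸ (hAm n).union hBm
      have hmeas : μ.real (A (n + 1)) = μ.real (A n) + μ.real B := by
        rw [hunion, measureReal_union hdisj (ℱ.le n _ hBm)]
      have hcompl : (A n)ᶜ = B ∪ (A (n + 1))ᶜ := by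
        rw [hunion, Set.compl_union]
        ext ω
        by_cases h1 : ω ∈ B
        · simp [h1, show ω ∉ A n from h1.1]
        · simp [h1]
      have hdisj' : Disjoint B (A (n + 1))ᶜ :=
        Set.disjoint_left.2 fun ω h1 h2 => h2 (hunion ▸ Or.inr h1)
      have hsplit : ∫ ω in (A n)ᶜ, f n ω ∂μ =
          ∫ ω in B, f n ω ∂μ + ∫ ω in (A (n + 1))ᶜ, f n ω ∂μ := by
        rw [hcompl, setIntegral_union hdisj' (ℱ.le n _ hAn1.compl)
          (hf.integrable n).integrableOn (hf.integrable n).integrableOn]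
      have hBle : c * μ.real B ≤ ∫ ω in B, f n ω ∂μ :=
        setIntegral_ge_of_const_le_real (ℱ.le n _ hBm) (measure_ne_top _ _) (fun ω h => h.2)
          (hf.integrable n).integrableOn
      have hdec := hf.setIntegral_le (Nat.le_succ n) hAn1.compl
      rw [hmeas, mul_add]
      linarith
  have hmono : Monotone A := fun m n hmn ω ⟨k, hk, hck⟩ => ⟨k, hk.trans_le hmn, hck⟩
  have hUn : {ω | ∃ n, c ≤ f n ω} = ⋃ n, A n := by
    ext ω
    simp only [hA, Set.mem_ofPred_eq, Set.mem_iUnion]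
    exact ⟨fun ⟨n, h⟩ => ⟨n + 1, n, by omega, h⟩, fun ⟨_, k, _, h⟩ => ⟨k, h⟩⟩
  have hlim : Filter.Tendsto (fun n => c * μ.real (A n)) Filter.atTop
      (nhds (c * μ.real {ω | ∃ n, c ≤ f n ω})) := by
    rw [hUn]
    refine Filter.Tendsto.const_mul c ?_
    exact (ENNReal.tendsto_toReal (measure_ne_top _ _)).comp (tendsto_measure_iUnion_atTop hmono)
  refine le_of_tendsto hlim (Filter.Eventually.of_forall fun n => ?_)
  have : 0 ≤ ∫ ω in (A n)ᶜ, f n ω ∂μ := integral_nonneg fun ω => hnonneg n ω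
  linarith [hstep n]

/-! ### The martingale of the Barabási–Albert process -/

lemma past_mono {Ω : Type*} (U : ℕ → Ω → ℕ) : Monotone (past U) := fun _ _ h =>
  biSup_mono fun _ hm => ⟨hm.1, hm.2.trans h⟩

lemma measurable_children_past {Ω : Type*} (U : ℕ → Ω → ℕ) (n i : ℕ) :
    Measurable[past U n] fun ω => children (fun m => U m ω) n i := by
  unfold children
  refine Finset.measurable_sum _ fun j hj => ?_
  have hj' := Finset.mem_Icc.1 hj
  have hUj : Measurable[past U n] (U j) := by
    rw [measurable_iff_comap_le]
    exact le_biSup (fun m => MeasurableSpace.comap (U m) ⊤) (show j ∈ Set.Icc 2 n from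
      ⟨by omega, hj'.2⟩)
  exact (measurable_from_top (f := fun k : ℕ => if k = i then 1 else 0)).comp hUj

lemma stronglyMeasurable_comp_children {Ω : Type*} (U : ℕ → Ω → ℕ) (n : ℕ)
    (g : ℕ → ℕ → ℝ) :
    StronglyMeasurable[past U n] fun ω =>
      g (children (fun m => U m ω) n 1) (children (fun m => U m ω) n 2) :=
  Measurable.stronglyMeasurable <|
    (Measurable.of_discrete (f := fun x : ℕ × ℕ => g x.1 x.2)).comp
      ((measurable_children_past U n 1).prodMk (measurable_children_past U n 2))

section

variable {Ω : Type*} [mΩ : MeasurableSpace Ω] {P : Measure Ω} {U : ℕ → Ω → ℕ}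

lemma IsProcess.past_le (hU : IsProcess P U) (n : ℕ) : past U n ≤ mΩ :=
  iSup₂_le fun m hm => (hU.measurable m hm.1).comap_le

/-- The filtration `F_3 ⊆ F_4 ⊆ …`, which starts at time `3`. -/
def IsProcess.filtration (hU : IsProcess P U) : Filtration ℕ mΩ where
  seq n := past U (n + 3)
  mono' _ _ h := past_mono U (by omega)
  le' n := hU.past_le (n + 3)

lemma integrable_comp_children [IsFiniteMeasure P] (hU : IsProcess P U) (n : ℕ) {g : ℕ → ℕ → ℝ}
    {C : ℝ} (hg : ∀ p q, |g p q| ≤ C) :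
    Integrable (fun ω => g (children (fun m => U m ω) n 1) (children (fun m => U m ω) n 2)) P :=
  Integrable.of_bound ((stronglyMeasurable_comp_children U n g).mono
    (hU.past_le n)).aestronglyMeasurable C (Filter.Eventually.of_forall fun _ => hg _ _)

lemma IsProcess.measurableSet_attach (hU : IsProcess P U) {n : ℕ} (hn : 2 ≤ n) (i : ℕ) :
    MeasurableSet {ω | U n ω = i} :=
  hU.measurable n hn (measurableSet_singleton i)

/-- The vertex `3` attaches to the vertex `1` or `2`, each with probability `1 / 2`. -/
lemma IsProcess.third [IsProbabilityMeasure P] (hU : IsProcess P U) :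
    ∀ᵐ ω ∂P, U 3 ω = 1 ∨ U 3 ω = 2 := by
  have hhalf : ∀ i, i = 1 ∨ i = 2 → P.real {ω | U 3 ω = i} = 1 / 2 := by
    intro i hi
    have h1 := integral_condExp (μ := P) (hU.past_le 2)
      (f := Set.indicator {ω | U 3 ω = i} fun _ => (1 : ℝ))
    rw [integral_indicator_const _ (hU.measurableSet_attach (by norm_num) i), smul_eq_mul,
      mul_one] at h1
    rw [← h1]
    have h2 : P[Set.indicator {ω | U 3 ω = i} (fun _ => (1 : ℝ)) | past U 2] =ᵐ[P]
        fun _ => (1 / 2 : ℝ) := by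
      filter_upwards [hU.attach 2 le_rfl i (by omega) (by omega), hU.second] with ω hω h2
      rw [hω, deg_eq_children_add_one h2 le_rfl hi]
      norm_num [children]
    rw [integral_congr_ae h2]
    simp
  have hm := hU.measurableSet_attach (n := 3) (by norm_num)
  have hun : P.real ({ω | U 3 ω = 1} ∪ {ω | U 3 ω = 2}) = 1 := by
    rw [measureReal_union ?_ (hm 2), hhalf 1 (Or.inl rfl), hhalf 2 (Or.inr rfl)]
    · norm_num
    · refine Set.disjoint_left.2 fun ω h1 h2 => ?_
      simp only [Set.mem_ofPred_eq] at h1 h2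
      omega
  have := (prob_compl_eq_zero_iff ((hm 1).union (hm 2))).2
    ((ENNReal.toReal_eq_one_iff _).1 hun)
  exact this

lemma IsProcess.one_le_children [IsProbabilityMeasure P] (hU : IsProcess P U) :
    ∀ᵐ ω ∂P, ∀ n, 3 ≤ n →
      1 ≤ children (fun m => U m ω) n 1 + children (fun m => U m ω) n 2 := by
  filter_upwards [hU.third] with ω hω n hn
  have hle : ∀ i, U 3 ω = i → 1 ≤ children (fun m => U m ω) n i := fun i hi => by
    calc 1 = if U 3 ω = i then 1 else 0 := by simp [hi]
      _ ≤ children (fun m => U m ω) n i :=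
        Finset.single_le_sum (f := fun j => if U j ω = i then 1 else 0)
          (fun _ _ => Nat.zero_le _) (Finset.mem_Icc.2 ⟨le_rfl, hn⟩)
  rcases hω with h | h
  · have := hle 1 h; omega
  · have := hle 2 h; omega

/-- The expected potential after one more attachment, given the past. -/
lemma IsProcess.condExp_potential_succ [IsProbabilityMeasure P] (hU : IsProcess P U) {s : ℝ}
    (hs0 : 0 ≤ s) (hs1 : s < 1) {n : ℕ} (hn : 3 ≤ n) :
    P[fun ω => potential s (children (fun m => U m ω) (n + 1) 1)
        (children (fun m => U m ω) (n + 1) 2) | past U n] =ᵐ[P]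
      fun ω => potential s (children (fun m => U m ω) n 1) (children (fun m => U m ω) n 2) *
        (1 - 3 * s / (2 * ((n : ℝ) - 1))) := by
  set I : ℕ → Ω → ℝ := fun i => Set.indicator {ω | U (n + 1) ω = i} fun _ => (1 : ℝ) with hI
  have hb : ∀ p q, |potential s p q| ≤ 1 := fun p q => by
    rw [abs_of_nonneg (potential_nonneg hs0 hs1.le p q)]
    exact potential_le_one hs0 hs1.le p q
  have hb2 : ∀ p q p' q', |potential s p q - potential s p' q'| ≤ 2 := fun p q p' q' => by
    linarith [abs_sub (potential s p q) (potential s p' q'), hb p q, hb p' q']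
  -- The potential, and its increments when the vertex `1` or the vertex `2` gets a child.
  set F : Ω → ℝ := fun ω =>
    potential s (children (fun m => U m ω) n 1) (children (fun m => U m ω) n 2) with hF
  set G : ℕ → Ω → ℝ := fun i ω =>
    potential s (children (fun m => U m ω) n 1 + if i = 1 then 1 else 0)
      (children (fun m => U m ω) n 2 + if i = 2 then 1 else 0) -
    potential s (children (fun m => U m ω) n 1) (children (fun m => U m ω) n 2) with hG
  have hFm : StronglyMeasurable[past U n] F := stronglyMeasurable_comp_children U n (potential s)
  have hGm : ∀ i, StronglyMeasurable[past U n] (G i) := fun i =>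
    stronglyMeasurable_comp_children U n fun p q =>
      potential s (p + if i = 1 then 1 else 0) (q + if i = 2 then 1 else 0) - potential s p q
  have hFi : Integrable F P := integrable_comp_children hU n hb
  have hIi : ∀ i, Integrable (I i) P := fun i =>
    (integrable_const (1 : ℝ)).indicator (hU.measurableSet_attach (by omega) i)
  have hGIi : ∀ i, Integrable (G i * I i) P := fun i =>
    (hIi i).bdd_mul (c := 2) ((hGm i).mono (hU.past_le n)).aestronglyMeasurable
      (Filter.Eventually.of_forall fun ω => hb2 _ _ _ _)
  have hdecomp : (fun ω => potential s (children (fun m => U m ω) (n + 1) 1)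
      (children (fun m => U m ω) (n + 1) 2)) = F + (G 1 * I 1 + G 2 * I 2) := by
    funext ω
    simp only [children_succ _ (by omega : 2 ≤ n), hF, hG, hI, Pi.add_apply, Pi.mul_apply,
      Set.indicator_apply, Set.mem_ofPred_eq]
    by_cases h1 : U (n + 1) ω = 1
    · simp [h1]
    · by_cases h2 : U (n + 1) ω = 2
      · simp [h2]
      · simp [h1, h2]
  rw [hdecomp]
  have c1 := condExp_add (m := past U n) hFi ((hGIi 1).add (hGIi 2))
  have c2 := condExp_add (m := past U n) (hGIi 1) (hGIi 2)
  have c3 := fun i => condExp_mul_of_stronglyMeasurable_left (hGm i) (hGIi i) (hIi i)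
  have c4 := condExp_of_stronglyMeasurable (hU.past_le n) hFm hFi
  filter_upwards [c1, c2, c3 1, c3 2, hU.attach n (by omega) 1 le_rfl (by omega),
    hU.attach n (by omega) 2 (by norm_num) (by omega), hU.second, hU.one_le_children]
    with ω h1 h2 h3 h4 h5 h6 h7 h8
  have hdrift := potential_drift hs1 (h8 n hn)
  rw [deg_eq_children_add_one h7 (by omega) (Or.inl rfl)] at h5
  rw [deg_eq_children_add_one h7 (by omega) (Or.inr rfl)] at h6
  rw [h1, Pi.add_apply, h2, Pi.add_apply, h3, h4, c4, Pi.mul_apply, Pi.mul_apply, h5, h6]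
  simp only [hF, hG, if_true, if_false, OfNat.ofNat_ne_one, OfNat.one_ne_ofNat, add_zero]
  have hn' : (3 : ℝ) ≤ n := by exact_mod_cast hn
  have hn1 : (n : ℝ) - 1 ≠ 0 := by linarith
  push_cast
  linear_combination (1 / (2 * ((n : ℝ) - 1))) * hdrift

/-- The normalized potential of the degrees of the vertices `1` and `2` is a martingale from time
`3` on. -/
lemma IsProcess.martingale_potential [IsProbabilityMeasure P] (hU : IsProcess P U) {s : ℝ}
    (hs0 : 0 ≤ s) (hs1 : s < 1) :
    Martingale (fun n ω => potential s (children (fun m => U m ω) (n + 3) 1)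
      (children (fun m => U m ω) (n + 3) 2) / decay s (n + 3)) hU.filtration P := by
  have hb : ∀ n p q, |potential s p q / decay s n| ≤ 1 / decay s n := fun n p q => by
    rw [abs_of_nonneg (div_nonneg (potential_nonneg hs0 hs1.le p q) (decay_pos hs1.le n).le)]
    exact div_le_div_of_nonneg_right (potential_le_one hs0 hs1.le p q) (decay_pos hs1.le n).le
  refine martingale_nat
    (fun n => stronglyMeasurable_comp_children U (n + 3) fun p q =>
      potential s p q / decay s (n + 3))
    (fun n => integrable_comp_children hU (n + 3) (hb (n + 3))) fun n => ?_
  have h1 := hU.condExp_potential_succ hs0 hs1 (n := n + 3) (by omega)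
  have h2 := condExp_smul (μ := P) (decay s (n + 4))⁻¹
    (fun ω => potential s (children (fun m => U m ω) (n + 4) 1)
        (children (fun m => U m ω) (n + 4) 2)) (past U (n + 3))
  have h3 : (fun ω => potential s (children (fun m => U m ω) (n + 1 + 3) 1)
      (children (fun m => U m ω) (n + 1 + 3) 2) / decay s (n + 1 + 3)) =
      (decay s (n + 4))⁻¹ • fun ω => potential s (children (fun m => U m ω) (n + 4) 1)
        (children (fun m => U m ω) (n + 4) 2) := by
    funext ω
    rw [Pi.smul_apply, smul_eq_mul, div_eq_inv_mul, show n + 1 + 3 = n + 4 by omega]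
  have h4 : decay s (n + 4) = decay s (n + 3) * (1 - 3 * s / (2 * (((n + 3 : ℕ) : ℝ) - 1))) :=
    decay_succ s (by omega)
  change _ =ᵐ[P] P[_ | past U (n + 3)]
  rw [h3]
  filter_upwards [h1, h2] with ω e1 e2
  rw [e2, Pi.smul_apply, smul_eq_mul]
  have hd3 := (decay_pos hs1.le (n + 3)).ne'
  have hd4 := (decay_pos hs1.le (n + 4)).ne'
  rw [e1]
  rw [h4] at hd4 ⊢
  generalize 1 - 3 * s / (2 * (((n + 3 : ℕ) : ℝ) - 1)) = y at hd4 ⊢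
  have hy := right_ne_zero_of_mul hd4
  field_simp

/-- The probability that Adam ever leaves the packet is `O(ε ^ s)` for each `s < 1`. -/
lemma IsProcess.measureReal_exists_notMem_packet_le [IsProbabilityMeasure P] (hU : IsProcess P U)
    {s : ℝ} (hs0 : 0 ≤ s) (hs1 : s < 1) {ε : ℝ} (hε : 0 < ε) (hε8 : ε < 1 / 8) :
    P.real {ω | ∃ n, 2 ≤ n ∧ 1 ∉ packet (fun m => U m ω) ε n} ≤ 54 * ε ^ s / (1 - s) ^ 3 := by
  have hεs : 0 < ε ^ s := Real.rpow_pos_of_pos hε s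
  have hs : 0 < (1 - s) ^ 3 := pow_pos (by linarith) 3
  set c : ℝ := (1 - s) ^ 3 / (54 * ε ^ s) with hc
  have hc0 : 0 < c := by positivity
  set M : ℕ → Ω → ℝ := fun n ω => potential s (children (fun m => U m ω) (n + 3) 1)
      (children (fun m => U m ω) (n + 3) 2) / decay s (n + 3) with hM
  have hville := measureReal_exists_le_of_supermartingale
    (hU.martingale_potential hs0 hs1).supermartingale
    (fun n ω => div_nonneg (potential_nonneg hs0 hs1.le _ _) (decay_pos hs1.le _).le) c
  have hstart : ∫ ω, M 0 ω ∂P ≤ 1 := by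
    calc ∫ ω, M 0 ω ∂P ≤ ∫ _, (1 : ℝ) ∂P := by
          refine integral_mono ((hU.martingale_potential hs0 hs1).integrable 0)
            (integrable_const 1) fun ω => ?_
          simpa [hM, decay] using potential_le_one hs0 hs1.le _ _
      _ = 1 := by simp
  have hsub : ∀ᵐ ω ∂P, (∃ n, 2 ≤ n ∧ 1 ∉ packet (fun m => U m ω) ε n) → ∃ n, c ≤ M n ω := by
    filter_upwards [hU.second, hU.one_le_children] with ω h2 hch
    rintro ⟨n, hn, hnot⟩
    rcases hn.eq_or_lt with rfl | hn3
    · -- At time `2` both degrees are `1`, and `(√π)⁻³ > 1 / 8`, so that Adam is in the packet.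
      exfalso
      have h := degree_product_le_of_notMem_packet h2 le_rfl hnot
      have hsq : √Real.pi ≤ 2 :=
        Real.sqrt_le_iff.2 ⟨by norm_num, by linarith [Real.pi_le_four]⟩
      have hsq3 : √Real.pi ^ 3 ≤ 2 ^ 3 := pow_le_pow_left₀ (Real.sqrt_nonneg _) hsq 3
      simp [children, alpha] at h
      nlinarith
    · obtain ⟨m, rfl⟩ : ∃ m, n = m + 3 := ⟨n - 3, by omega⟩
      exact ⟨m, le_potential_div_decay_of_notMem_packet hs0 hs1.le h2 (by omega)
        (hch _ (by omega)) hε hnot⟩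
  have hle : P.real {ω | ∃ n, 2 ≤ n ∧ 1 ∉ packet (fun m => U m ω) ε n} ≤
      P.real {ω | ∃ n, c ≤ M n ω} :=
    ENNReal.toReal_mono (measure_ne_top _ _) (measure_mono_ae hsub)
  calc _ ≤ P.real {ω | ∃ n, c ≤ M n ω} := hle
    _ ≤ 1 / c := by
      rw [le_div_iff₀ hc0, mul_comm]
      exact hville.trans hstart
    _ = 54 * ε ^ s / (1 - s) ^ 3 := by rw [hc, one_div_div]

end

end BarabasiAlbert

theorem proposition2 (η : ℝ) (hη0 : 0 < η) (hη1 : η < 1) :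
    ∃ ε₀ : ℝ, 0 < ε₀ ∧ ∀ ε : ℝ, 0 < ε → ε < ε₀ →
      ∀ (Ω : Type*) [MeasurableSpace Ω] (P : MeasureTheory.Measure Ω)
        [MeasureTheory.IsProbabilityMeasure P] (U : ℕ → Ω → ℕ),
        BarabasiAlbert.IsProcess P U →
          1 - ε ^ (1 - η) ≤
            P.real {ω | ∀ n : ℕ, 2 ≤ n →
              1 ∈ BarabasiAlbert.packet (fun m => U m ω) ε n} := by
  -- The exponent `s = 1 - η / 2` leaves a factor `ε ^ (η / 2)` to absorb the constant.
  set C : ℝ := 54 / (η / 2) ^ 3 with hC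
  have hC0 : 0 < C := by positivity
  refine ⟨min (1 / 8) (C⁻¹ ^ (2 / η)), lt_min (by norm_num) (by positivity), ?_⟩
  intro ε hε hε0 Ω _ P _ U hU
  have hbad := hU.measureReal_exists_notMem_packet_le (s := 1 - η / 2) (by linarith)
    (by linarith) hε (hε0.trans_le (min_le_left _ _))
  have hsmall : ε ^ (η / 2) ≤ C⁻¹ := by
    calc ε ^ (η / 2) ≤ (C⁻¹ ^ (2 / η)) ^ (η / 2) :=
          Real.rpow_le_rpow hε.le (hε0.trans_le (min_le_right _ _)).le (by positivity)
      _ = C⁻¹ := by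
        rw [← Real.rpow_mul (by positivity), show 2 / η * (η / 2) = 1 by field_simp,
          Real.rpow_one]
  have hpow : 54 * ε ^ (1 - η / 2) / (1 - (1 - η / 2)) ^ 3 ≤ ε ^ (1 - η) := by
    calc 54 * ε ^ (1 - η / 2) / (1 - (1 - η / 2)) ^ 3
        = ε ^ (1 - η) * (C * ε ^ (η / 2)) := by
          rw [show 1 - η / 2 = (1 - η) + η / 2 by ring, Real.rpow_add hε, hC]
          ring
      _ ≤ ε ^ (1 - η) * 1 := by
          refine mul_le_mul_of_nonneg_left ?_ (Real.rpow_nonneg hε.le _)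
          calc C * ε ^ (η / 2) ≤ C * C⁻¹ := mul_le_mul_of_nonneg_left hsmall hC0.le
            _ = 1 := mul_inv_cancel₀ hC0.ne'
      _ = ε ^ (1 - η) := mul_one _
  -- Subadditivity suffices here, so the measurability of these events plays no role.
  have hcover : (1 : ℝ) ≤ P.real {ω | ∀ n : ℕ, 2 ≤ n →
        1 ∈ BarabasiAlbert.packet (fun m => U m ω) ε n} +
      P.real {ω | ∃ n, 2 ≤ n ∧ 1 ∉ BarabasiAlbert.packet (fun m => U m ω) ε n} := by
    refine le_trans (le_of_eq ?_) (measureReal_union_le _ _)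
    rw [← probReal_univ (μ := P)]
    congr 1
    ext ω
    simp only [Set.mem_univ, Set.mem_union, Set.mem_ofPred_eq, true_iff]
    by_contra! h
    exact absurd h.1 (by simpa using h.2)
  linarith
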